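/- Let $\Omega\subset\mathbb R^2$ be a bounded domain (non-empty, open, connected, bounded) and let $\mathbf Q=\begin{pmatrix}0&-1\\1&0\end{pmatrix}$. For $c\neq 0$ consider the problem $(P_c)$ of minimising $$\frac12\int_\Omega\big(|\nabla u|^2+|\nabla v|^2\big)\,dx\quad\text{over }(u,v)\in H^1(\Omega;\mathbb R^2)\quad\text{subject to}\quad\int_\Omega\det(\nabla u,\nabla v)\,dx=c .$$ (a) For every $c>0$ there is a minimiser $(u,v)$ of $(P_c)$ such that $u$ and $v$ are harmonic in $\Omega$, neither $u$ nor $v$ is constant in $\Omega$, and the Cauchy–Riemann equations $\nabla u+\mathbf Q\nabla v=\mathbf 0$ hold everywhere in $\Omega$. In particular there are non-trivial pairs of harmonic functions in $\Omega$ that satisfy the Cauchy–Riemann equations. (b) For every $c\neq0$ the problem $(P_c)$ has a minimiser. Every minimiser $(u,v)$ of $(P_c)$, with $s=\operatorname{sign}(c)\in\{1,-1\}$, satisfies the optimality conditions $$\int_\Omega(\nabla u+s\,\mathbf Q\nabla v)\cdot\nabla U\,dx=0,\qquad \int_\Omega(\nabla v-s\,\mathbf Q\nabla u)\cdot\nabla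 U\,dx=0\qquad\text{for all }U\in H^1(\Omega),$$ and, after modification on a null set, $u$ and $v$ are harmonic in $\Omega$, neither is constant in $\Omega$, and $\nabla u+s\,\mathbf Q\nabla v=\mathbf 0$ everywhere in $\Omega$. (For $c<0$ this says that $(u,-v)$ satisfies the Cauchy–Riemann equations.) -/

import Mathlib

open MeasureTheory InnerProductSpace
open scoped ContDiff Gradient Matrix

noncomputable section

/-- The Euclidean plane. -/
abbrev Plane : Type := EuclideanSpace ℝ (Fin 2)

/-- The action of the matrix `Q = !![0, -1; 1, 0]` on a vector of the plane. -/
def rotQ (p : Plane) : Plane := WithLp.toLp 2 (!![0, -1; 1, 0] *ᵥ p.ofLp)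

/-- The determinant of the matrix with rows `p` and `q`. -/
def detPair (p q : Plane) : ℝ := Matrix.det !![p 0, p 1; q 0, q 1]

/-- `g` is a gradient of `u` in the sense of distributions on `Ω`:
`∫_Ω u ∂ᵢφ = -∫_Ω gᵢ φ` for all test functions `φ ∈ C_c^∞(Ω)` and `i = 0, 1`. -/
def IsWeakGradient (Ω : Set Plane) (u : Plane → ℝ) (g : Plane → Plane) : Prop :=
  ∀ φ : Plane → ℝ, ContDiff ℝ ∞ φ → HasCompactSupport φ → tsupport φ ⊆ Ω →
    ∀ i : Fin 2, ∫ x in Ω, u x * fderiv ℝ φ x (EuclideanSpace.single i 1) =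
      -∫ x in Ω, g x i * φ x

/-- The Sobolev space `H¹(Ω)`: functions in `L²(Ω)` with a weak gradient in `L²(Ω)`. -/
def MemH1 (Ω : Set Plane) (u : Plane → ℝ) : Prop :=
  MemLp u 2 (volume.restrict Ω) ∧
    ∃ g : Plane → Plane, MemLp g 2 (volume.restrict Ω) ∧ IsWeakGradient Ω u g

open Classical in
/-- The weak gradient of a function `u ∈ H¹(Ω)` (a version of it; it is unique up to null sets
when `Ω` is open); zero by convention if `u ∉ H¹(Ω)`. -/
def weakGrad (Ω : Set Plane) (u : Plane → ℝ) : Plane → Plane :=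
  if h : MemH1 Ω u then h.2.choose else 0

theorem weakGrad_spec {Ω : Set Plane} {u : Plane → ℝ} (h : MemH1 Ω u) :
    MemLp (weakGrad Ω u) 2 (volume.restrict Ω) ∧ IsWeakGradient Ω u (weakGrad Ω u) := by
  unfold weakGrad
  rw [dif_pos h]
  exact h.2.choose_spec

/-- The Dirichlet energy `½ ∫_Ω (|∇u|² + |∇v|²)`. -/
def dirichletEnergy (Ω : Set Plane) (u v : Plane → ℝ) : ℝ :=
  (1 / 2) * ∫ x in Ω, (‖weakGrad Ω u x‖ ^ 2 + ‖weakGrad Ω v x‖ ^ 2)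

/-- `(u, v)` is admissible: `(u, v) ∈ H¹(Ω; ℝ²)` and `∫_Ω det(∇u, ∇v) = c`. -/
def IsAdmissible (Ω : Set Plane) (c : ℝ) (u v : Plane → ℝ) : Prop :=
  MemH1 Ω u ∧ MemH1 Ω v ∧ ∫ x in Ω, detPair (weakGrad Ω u x) (weakGrad Ω v x) = c

/-- `(u, v)` minimises the Dirichlet energy among all admissible pairs. -/
def IsConstrainedMinimizer (Ω : Set Plane) (c : ℝ) (u v : Plane → ℝ) : Prop :=
  IsAdmissible Ω c u v ∧
    ∀ u' v' : Plane → ℝ, IsAdmissible Ω c u' v' →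
      dirichletEnergy Ω u v ≤ dirichletEnergy Ω u' v'

/-- The optimality conditions of the functional
`∫_Ω (½|∇u|² + ½|∇v|² + s ∇u · Q∇v)` for free variations in `H¹(Ω)`: the weak form of
`div (∇u + s Q∇v) = 0`, `div (∇v - s Q∇u) = 0` in `Ω`, with natural boundary conditions. -/
def SatisfiesOptimality (Ω : Set Plane) (s : ℝ) (u v : Plane → ℝ) : Prop :=
  ∀ U : Plane → ℝ, MemH1 Ω U →
    ∫ x in Ω, inner ℝ (weakGrad Ω u x + s • rotQ (weakGrad Ω v x)) (weakGrad Ω U x) = 0 ∧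
    ∫ x in Ω, inner ℝ (weakGrad Ω v x - s • rotQ (weakGrad Ω u x)) (weakGrad Ω U x) = 0

/-- `u` and `v` are harmonic in `Ω`, neither is constant in `Ω`, and
`∇u + s Q∇v = 0` at every point of `Ω` (classical gradients). -/
def IsNontrivialConjugatePair (Ω : Set Plane) (s : ℝ) (u v : Plane → ℝ) : Prop :=
  HarmonicOnNhd u Ω ∧ HarmonicOnNhd v Ω ∧
  (¬ ∃ a : ℝ, ∀ x ∈ Ω, u x = a) ∧ (¬ ∃ a : ℝ, ∀ x ∈ Ω, v x = a) ∧
  ∀ x ∈ Ω, ∇ u x + s • rotQ (∇ v x) = 0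

end

/-! The constraint is a null Lagrangian that completes a square. Since `Q` is an isometry and `p ·
Qq = -det(p, q)`, for `s = ±1` the energy of an admissible pair is `s c + ½ ∫ |∇u + s Q∇v|²`
(`dirichletEnergy_eq`). With `s` the sign of `c`, the bound `s c` is attained by the linear pair `(a
x₀, s a x₁)` for a suitable `a` (`exists_linear_admissible`), so no compactness argument is needed.
Hence the minimisers are exactly the admissible pairs with `∇u + s Q∇v = 0` almost everywhere
(`isConstrainedMinimizer_iff`), and the optimality conditions follow pointwise.

Regularity is Weyl's lemma for the Cauchy–Riemann operator: `u + i s v` is a weak solution, hence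
almost everywhere equal to a holomorphic `G` (`exists_differentiableOn_of_weak_cauchyRiemann`), and
`Re G`, `s Im G` are the required representatives. Neither is constant, since a constant component
would make the determinant integral vanish. -/

/-! ### Weyl's lemma for the Cauchy–Riemann equations on `ℂ` -/

open Complex Metric Filter Topology Convolution in
/-- The mean value property of holomorphic functions against a radial weight. -/
theorem integral_radial_smul_eq {h : ℂ → ℂ} {η : ℂ → ℝ} {x : ℂ} {R R' : ℝ} (hRR' : R < R')
    (hcont : Continuous h) (hh : DifferentiableOn ℂ h (ball x R')) (hη : Continuous η)
    (hrad : ∀ w t : ℂ, ‖w‖ = 1 → η (w * t) = η t) (hsupp : ∀ t, R < ‖t‖ → η t = 0) :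
    ∫ t, η t • h (x - t) = (∫ t, η t) • h x := by
  have hπ : (0 : ℝ) ≤ 2 * Real.pi := by positivity
  set S : Set ℂ := closedBall 0 R
  have hS : ∀ k : ℂ → ℂ, ∫ t in S, η t • k t = ∫ t, η t • k t := fun k ↦
    setIntegral_eq_integral_of_forall_compl_eq_zero fun t ht ↦ by
      rw [hsupp t (by simpa [S] using ht), zero_smul]
  -- Lebesgue measure and `η` are both rotation invariant, so this integral does not depend on `θ`
  -- and may be averaged over the circle.
  have hrot : ∀ θ : ℝ, ∫ t in S, η t • h (x - circleMap 0 1 θ * t) =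
      ∫ t, η t • h (x - t) := fun θ ↦ by
    have hn : ‖circleMap 0 1 θ‖ = 1 := by simp
    have e : ∀ t, rotation ⟨circleMap 0 1 θ, by simp [Submonoid.unitSphere]⟩ t =
      circleMap 0 1 θ * t := fun t ↦ rfl
    have := (LinearIsometryEquiv.measurePreserving
      (rotation ⟨circleMap 0 1 θ, by simp [Submonoid.unitSphere]⟩)).integral_comp
      (rotation ⟨circleMap 0 1 θ, by simp [Submonoid.unitSphere]⟩).toHomeomorph.measurableEmbedding
      (fun t ↦ η t • h (x - t))
    rw [hS fun t ↦ h (x - circleMap 0 1 θ * t), ← this]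
    refine integral_congr_ae (.of_forall fun t ↦ ?_)
    simp only [e, hrad _ t hn]
  -- For fixed `t`, the function `w ↦ h (x - w * t)` is holomorphic near the closed unit disc
  -- because `‖t‖ ≤ R < R'`; its circle average is its value at `w = 0`.
  have havg : ∀ t ∈ S, ∫ θ in (0 : ℝ)..2 * Real.pi, h (x - circleMap 0 1 θ * t) =
      (2 * Real.pi) • h x := fun t ht ↦ by
    have ht' : ‖t‖ ≤ R := by simpa [S] using ht
    have hd : DiffContOnCl ℂ (fun w : ℂ ↦ h (x - w * t)) (ball 0 |1|) := by
      have : DifferentiableOn ℂ (fun w : ℂ ↦ h (x - w * t)) (closedBall 0 |1|) := by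
        refine hh.comp (by fun_prop) fun w hw ↦ ?_
        simp only [abs_one, mem_closedBall, dist_zero_right] at hw
        simp only [mem_ball, dist_self_sub_left, norm_mul]
        nlinarith [norm_nonneg t, norm_nonneg w]
      exact this.diffContOnCl_ball subset_rfl
    have := hd.circleAverage
    rw [Real.circleAverage_def] at this
    simp only [zero_mul, sub_zero] at this
    rw [← this, smul_smul, mul_inv_cancel₀ (by positivity), one_smul]
  have hint : Integrable (Function.uncurry fun (θ : ℝ) (t : ℂ) ↦
      η t • h (x - circleMap 0 1 θ * t))
      ((volume.restrict (Set.Ioc 0 (2 * Real.pi))).prod (volume.restrict S)) := by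
    rw [Measure.prod_restrict]
    refine IntegrableOn.mono_set (t := Set.Icc 0 (2 * Real.pi) ×ˢ S) ?_
      (Set.prod_mono Set.Ioc_subset_Icc_self subset_rfl)
    refine ContinuousOn.integrableOn_compact (isCompact_Icc.prod (isCompact_closedBall _ _)) ?_
    refine Continuous.continuousOn ?_
    simp only [Function.uncurry_def]
    fun_prop
  have hswap := integral_integral_swap hint
  simp only [hrot, integral_smul] at hswap
  rw [setIntegral_congr_fun (g := fun t ↦ η t • ((2 * Real.pi) • h x)) measurableSet_closedBall
    fun t ht ↦ by simp only [← havg t ht, intervalIntegral.integral_of_le hπ],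
    hS fun _ ↦ (2 * Real.pi) • h x, integral_smul_const] at hswap
  simp only [integral_const, MeasurableSet.univ, measureReal_restrict_apply, Set.univ_inter,
    Real.volume_real_Ioc, sub_zero, max_eq_left hπ] at hswap
  rw [smul_comm] at hswap
  exact smul_right_injective ℂ (by positivity : (2 * Real.pi) ≠ 0) hswap

-- All derivatives fall on `φ`, so `F` need only be locally integrable. The formula in each
-- direction `v` lets the directions `1` and `I` be compared through the weak equation.
open Convolution in
theorem exists_hasFDerivAt_convolution {E : Type*} [NormedAddCommGroup E] [NormedSpace ℝ E]
    {F : ℂ → E} (L : ℝ →L[ℝ] E →L[ℝ] E) (hF : LocallyIntegrable F) {φ : ℂ → ℝ}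
    (hφ : ContDiff ℝ 1 φ) (hc : HasCompactSupport φ) (y : ℂ) :
    ∃ A : ℂ →L[ℝ] E, HasFDerivAt (φ ⋆[L] F) A y ∧
      ∀ v, A v = ∫ t, L (fderiv ℝ φ (y - t) v) (F t) := by
  have hint : Integrable fun t ↦ L.precompL ℂ (fderiv ℝ φ t) (F (y - t)) :=
    (hc.fderiv (𝕜 := ℝ)).convolutionExists_left (L.precompL ℂ)
      (hφ.continuous_fderiv one_ne_zero) hF y
  refine ⟨_, hc.hasFDerivAt_convolution_left L hφ hF y, fun v ↦ ?_⟩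
  have h1 := ContinuousLinearMap.integral_apply hint v
  have h2 := integral_sub_left_eq_self (fun t ↦ L (fderiv ℝ φ (y - t) v) (F t)) volume y
  simp only [sub_sub_cancel] at h2
  rw [← h2]
  exact h1

open Complex Metric Filter Topology Convolution in
/-- Mollifications of a weak solution of the Cauchy–Riemann equations are holomorphic. -/
theorem differentiableAt_convolution_of_weak_cauchyRiemann {U : Set ℂ} {F : ℂ → ℂ}
    (hF : LocallyIntegrable F)
    (hw : ∀ ψ : ℂ → ℝ, ContDiff ℝ ∞ ψ → HasCompactSupport ψ → tsupport ψ ⊆ U →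
      ∫ t, (fderiv ℝ ψ t I) • F t = I • ∫ t, (fderiv ℝ ψ t 1) • F t)
    {φ : ℂ → ℝ} (hφ : ContDiff ℝ ∞ φ) {δ : ℝ} (hsupp : tsupport φ ⊆ closedBall 0 δ) {y : ℂ}
    (hy : closedBall y δ ⊆ U) :
    DifferentiableAt ℂ (φ ⋆[ContinuousLinearMap.lsmul ℝ ℝ] F) y := by
  have hc : HasCompactSupport φ := (isCompact_closedBall 0 δ).of_isClosed_subset
    (isClosed_tsupport φ) hsupp
  obtain ⟨A, hA, happ⟩ := exists_hasFDerivAt_convolution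
    (ContinuousLinearMap.lsmul ℝ ℝ) hF (hφ.of_le (by simp)) hc y
  simp only [ContinuousLinearMap.lsmul_apply] at happ
  rw [differentiableAt_complex_iff_differentiableAt_real]
  refine ⟨hA.differentiableAt, ?_⟩
  rw [hA.fderiv]
  -- The derivative of the convolution at `y` tests `F` against derivatives of this reflected
  -- kernel, which is supported in the closed `δ`-ball about `y`, hence in `U`.
  set ψ : ℂ → ℝ := fun t ↦ φ (y - t)
  have hψ : ∀ t v, fderiv ℝ ψ t v = - fderiv ℝ φ (y - t) v := fun t v ↦ by
    have := ((hφ.differentiable (by simp)).differentiableAt (x := y - t)).hasFDerivAt.comp t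
      ((hasFDerivAt_id t).const_sub y)
    rw [show ψ = φ ∘ fun t ↦ y - t from rfl, this.fderiv]
    simp
  have hts : tsupport ψ ⊆ closedBall y δ := by
    refine closure_minimal (fun t ht ↦ ?_) isClosed_closedBall
    have := hsupp (subset_tsupport φ ht)
    simpa [dist_eq_norm, norm_sub_rev] using this
  have := hw ψ (by fun_prop) ((isCompact_closedBall y δ).of_isClosed_subset
    (isClosed_tsupport ψ) hts) (hts.trans hy)
  simp only [hψ, neg_smul, integral_neg, smul_neg, neg_inj] at this
  rw [happ, happ, this]

-- By associativity both sides are the convolution of `F` with a product kernel, and convolution of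
-- scalar kernels commutes.
open Complex Metric Filter Topology Convolution in
theorem convolution_lsmul_left_comm {φ η : ℂ → ℝ} {F : ℂ → ℂ} (hφ : Continuous φ)
    (hcφ : HasCompactSupport φ) (hη : Continuous η) (hcη : HasCompactSupport η)
    (hF : LocallyIntegrable F) (x : ℂ) :
    (φ ⋆[ContinuousLinearMap.lsmul ℝ ℝ] (η ⋆[ContinuousLinearMap.lsmul ℝ ℝ] F)) x =
      (η ⋆[ContinuousLinearMap.lsmul ℝ ℝ] (φ ⋆[ContinuousLinearMap.lsmul ℝ ℝ] F)) x := by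
  have hFn : LocallyIntegrable fun t ↦ ‖F t‖ := fun t ↦ (hF t).norm
  have key : ∀ {f g : ℂ → ℝ}, Continuous f → HasCompactSupport f → Continuous g →
      HasCompactSupport g →
      ((f ⋆[ContinuousLinearMap.mul ℝ ℝ] g) ⋆[ContinuousLinearMap.lsmul ℝ ℝ] F) x =
      (f ⋆[ContinuousLinearMap.lsmul ℝ ℝ] (g ⋆[ContinuousLinearMap.lsmul ℝ ℝ] F)) x := by
    intro f g hf hcf hg hcg
    refine convolution_assoc _ _ _ _ (fun a b z ↦ by simp [mul_smul]) hf.aestronglyMeasurable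
      hg.aestronglyMeasurable hF.aestronglyMeasurable
      (.of_forall (hcf.convolutionExists_left _ hf hg.locallyIntegrable))
      (.of_forall (hcg.norm.convolutionExists_left _ hg.norm hFn)) ?_
    exact hcf.norm.convolutionExists_left _ hf.norm
      (hcg.norm.continuous_convolution_left _ hg.norm hFn).locallyIntegrable x
  rw [← key hφ hcφ hη hcη, ← key hη hcη hφ hcφ,
    ← convolution_flip (ContinuousLinearMap.mul ℝ ℝ) (f := φ) (g := η),
    ContinuousLinearMap.flip_mul]

open Metric in
theorem exists_radial_mollifier {r : ℝ} (hr : 0 < r) :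
    ∃ η : ℂ → ℝ, ContDiff ℝ ∞ η ∧ tsupport η ⊆ closedBall 0 r ∧
      (∀ w t : ℂ, ‖w‖ = 1 → η (w * t) = η t) ∧ ∫ t, η t = 1 := by
  -- The profile is a function of `‖z‖ ^ 2`, which is smooth at the origin, unlike `‖z‖`; hence the
  -- squared radii.
  set ρ : ContDiffBump (0 : ℝ) := ⟨r ^ 2 / 2, r ^ 2, by positivity, by nlinarith [pow_pos hr 2]⟩
  set η : ℂ → ℝ := fun z ↦ ρ (‖z‖ ^ 2)
  have hη : ContDiff ℝ ∞ η := ρ.contDiff.comp (contDiff_norm_sq ℝ)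
  have hs : tsupport η ⊆ closedBall 0 r := by
    refine closure_minimal (fun t ht ↦ ?_) isClosed_closedBall
    have : ‖t‖ ^ 2 ∈ Function.support ρ := ht
    rw [ρ.support_eq, mem_ball_zero_iff, Real.norm_of_nonneg (by positivity)] at this
    rw [mem_closedBall_zero_iff]
    exact (lt_of_pow_lt_pow_left₀ 2 hr.le this).le
  have hc : HasCompactSupport η := (isCompact_closedBall 0 r).of_isClosed_subset
    (isClosed_tsupport η) hs
  have hpos : 0 < ∫ t, η t := by
    refine hη.continuous.integral_pos_of_hasCompactSupport_nonneg_nonzero hc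
      (fun t ↦ ρ.nonneg) (x := 0) ?_
    have : ρ 0 = 1 := ρ.one_of_mem_closedBall (by simp; positivity)
    simp [η, this]
  refine ⟨fun z ↦ (∫ t, η t)⁻¹ * η z, contDiff_const.mul hη,
    (closure_mono fun t ht ↦ ?_).trans hs, fun w t hw ↦ by simp [η, hw], ?_⟩
  · exact right_ne_zero_of_mul ht
  · rw [integral_const_mul, inv_mul_cancel₀ hpos.ne']

open Complex Metric Filter Topology Convolution in
/-- **Weyl's lemma** for the Cauchy–Riemann equations: a locally integrable weak solution is almost
everywhere equal to a holomorphic function. -/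
theorem exists_differentiableOn_of_weak_cauchyRiemann {U : Set ℂ} (hU : IsOpen U) {F : ℂ → ℂ}
    (hF : LocallyIntegrable F)
    (hw : ∀ ψ : ℂ → ℝ, ContDiff ℝ ∞ ψ → HasCompactSupport ψ → tsupport ψ ⊆ U →
      ∫ t, (fderiv ℝ ψ t I) • F t = I • ∫ t, (fderiv ℝ ψ t 1) • F t) :
    ∃ G : ℂ → ℂ, DifferentiableOn ℂ G U ∧ ∀ᵐ z, z ∈ U → G z = F z := by
  set φ : ℕ → ContDiffBump (0 : ℂ) := fun n ↦
    ⟨1 / ((n : ℝ) + 1) / 2, 1 / ((n : ℝ) + 1), by positivity, half_lt_self (by positivity)⟩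
  have hφ0 : Tendsto (fun n ↦ (φ n).rOut) atTop (𝓝 0) := tendsto_one_div_add_atTop_nhds_zero_nat
  have hφs : ∀ n, tsupport ((φ n).normed volume) ⊆ closedBall 0 (φ n).rOut := fun n ↦
    ((φ n).tsupport_normed_eq (μ := volume)).subset
  set f : ℕ → ℂ → ℂ := fun n ↦
    (φ n).normed volume ⋆[ContinuousLinearMap.lsmul ℝ ℝ] F
  have hfc : ∀ n, Continuous (f n) := fun n ↦
    (φ n).hasCompactSupport_normed.continuous_convolution_left _ (φ n).continuous_normed hF
  have hae : ∀ᵐ z, Tendsto (fun n ↦ f n z) atTop (𝓝 (F z)) :=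
    ContDiffBump.ae_convolution_tendsto_right_of_locallyIntegrable (K := 2) hφ0
      (.of_forall fun n ↦ le_of_eq (by simp only [φ]; ring)) hF
  -- The representative is the pointwise limit of the mollifications: it is `F` almost everywhere,
  -- and near each point of `U` it coincides with one fixed smooth convolution.
  refine ⟨fun z ↦ limUnder atTop fun n ↦ f n z, fun x hx ↦ ?_, ?_⟩
  · obtain ⟨ε, hε, hball⟩ := Metric.isOpen_iff.1 hU x hx
    -- The budget is `r` for `y` about `x`, `2 * r` for the disc about `y` on which `f n` is
    -- holomorphic, and `r` for the support of `φ n`.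
    obtain ⟨r, hr, hrε⟩ : ∃ r : ℝ, 0 < r ∧ 4 * r = ε := ⟨ε / 4, by positivity, by ring⟩
    obtain ⟨η, hη, hηs, hrad, hη1⟩ := exists_radial_mollifier hr
    have hηc : HasCompactSupport η := (isCompact_closedBall 0 r).of_isClosed_subset
      (isClosed_tsupport η) hηs
    -- With `η` radial of mass one, the mean value property gives `f n = η ⋆ f n = φ n ⋆ (η ⋆ F)` at
    -- `y` for large `n`, and this tends to the continuous function `η ⋆ F`.
    have hlim : ∀ y ∈ ball x r, Tendsto (fun n ↦ f n y) atTop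
        (𝓝 ((η ⋆[ContinuousLinearMap.lsmul ℝ ℝ] F) y)) := fun y hy ↦ by
      have h1 := ContDiffBump.convolution_tendsto_right_of_continuous (μ := volume) hφ0
        (hηc.continuous_convolution_left (ContinuousLinearMap.lsmul ℝ ℝ) hη.continuous hF) y
      refine h1.congr' ?_
      filter_upwards [hφ0.eventually_lt_const hr] with n hn
      rw [convolution_lsmul_left_comm (φ n).continuous_normed (φ n).hasCompactSupport_normed
        hη.continuous hηc hF]
      have hd : DifferentiableOn ℂ (f n) (ball y (2 * r)) := fun z hz ↦
        (differentiableAt_convolution_of_weak_cauchyRiemann hF hw (φ n).contDiff_normed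
          (hφs n) (fun w hw ↦ hball ?_)).differentiableWithinAt
      · have := integral_radial_smul_eq (R := r) (by linarith) (hfc n) hd hη.continuous hrad
          fun t ht ↦ image_eq_zero_of_notMem_tsupport fun h ↦ by
            have := hηs h
            rw [mem_closedBall_zero_iff] at this
            linarith
        rw [hη1, one_smul] at this
        exact this
      · rw [mem_closedBall] at hw
        rw [mem_ball] at hz hy ⊢
        linarith [dist_triangle w z x, dist_triangle z y x]
    have hd : DifferentiableAt ℂ (η ⋆[ContinuousLinearMap.lsmul ℝ ℝ] F) x :=
      differentiableAt_convolution_of_weak_cauchyRiemann hF hw hη hηs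
        ((closedBall_subset_ball (by linarith)).trans hball)
    refine (hd.congr_of_eventuallyEq ?_).differentiableWithinAt
    filter_upwards [ball_mem_nhds x hr] with y hy using (hlim y hy).limUnder_eq
  · filter_upwards [hae] with z hz _ using hz.limUnder_eq

/-! ### Harmonicity and the Cauchy–Riemann equations in plane coordinates -/

/-- The Laplacian can be computed in any orthonormal basis, and `e` carries one such basis to
another. -/
theorem HarmonicAt.comp_linearIsometryEquiv {E E' F : Type*} [NormedAddCommGroup E]
    [InnerProductSpace ℝ E] [FiniteDimensional ℝ E] [NormedAddCommGroup E']
    [InnerProductSpace ℝ E'] [FiniteDimensional ℝ E'] [NormedAddCommGroup F] [NormedSpace ℝ F]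
    (e : E' ≃ₗᵢ[ℝ] E) {h : E → F} {x : E'} (hh : HarmonicAt h (e x)) :
    HarmonicAt (h ∘ e) x := by
  have hΔ : ∀ y, Laplacian.laplacian (h ∘ e) y = Laplacian.laplacian h (e y) := fun y ↦ by
    rw [laplacian_eq_iteratedFDeriv_orthonormalBasis _ (stdOrthonormalBasis ℝ E'),
      laplacian_eq_iteratedFDeriv_orthonormalBasis _ ((stdOrthonormalBasis ℝ E').map e)]
    refine Finset.sum_congr rfl fun i _ ↦ ?_
    have := e.toContinuousLinearEquiv.iteratedFDerivWithin_comp_right h uniqueDiffOn_univ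
      (x := y) (Set.mem_univ _) 2
    simp only [Set.preimage_univ, iteratedFDerivWithin_univ] at this
    rw [show h ∘ e = h ∘ e.toContinuousLinearEquiv from rfl, this]
    simp only [ContinuousMultilinearMap.compContinuousLinearMap_apply]
    congr 1
    ext j
    fin_cases j <;> rfl
  refine ⟨hh.1.comp x e.contDiff.contDiffAt, ?_⟩
  filter_upwards [e.continuous.continuousAt.eventually hh.2] with y hy
  rw [hΔ, hy]
  rfl

theorem gradient_apply_eq_fderiv (f : Plane → ℝ) (x : Plane) (i : Fin 2) :
    ∇ f x i = fderiv ℝ f x (EuclideanSpace.single i 1) := by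
  rw [← inner_gradient_left, EuclideanSpace.inner_single_right]
  simp

theorem rotQ_apply_zero (p : Plane) : rotQ p 0 = - p 1 := by simp [rotQ, dotProduct]

theorem rotQ_apply_one (p : Plane) : rotQ p 1 = p 0 := by simp [rotQ, dotProduct]

theorem detPair_eq (p q : Plane) : detPair p q = p 0 * q 1 - p 1 * q 0 := by
  simp [detPair, Matrix.det_fin_two]

/-- The isometric identification of the complex numbers with the plane. -/
noncomputable abbrev complexToPlane : ℂ ≃ₗᵢ[ℝ] Plane := Complex.orthonormalBasisOneI.repr

theorem complexToPlane_symm_single_zero :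
    complexToPlane.symm (EuclideanSpace.single 0 1) = 1 := by
  simp

theorem complexToPlane_symm_single_one :
    complexToPlane.symm (EuclideanSpace.single 1 1) = Complex.I := by
  simp

/-- The real part of a holomorphic function and its imaginary part, up to a sign, are harmonic and
satisfy the Cauchy–Riemann equations, with that sign. -/
theorem harmonic_cauchyRiemann_of_differentiableOn {Ω : Set Plane} (hΩ : IsOpen Ω) {s : ℝ}
    (hs : s * s = 1) {G : ℂ → ℂ} (hG : DifferentiableOn ℂ G (complexToPlane ⁻¹' Ω)) :
    HarmonicOnNhd (fun x ↦ (G (complexToPlane.symm x)).re) Ω ∧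
    HarmonicOnNhd (fun x ↦ s * (G (complexToPlane.symm x)).im) Ω ∧
    ∀ x ∈ Ω, ∇ (fun x ↦ (G (complexToPlane.symm x)).re) x +
      s • rotQ (∇ (fun x ↦ s * (G (complexToPlane.symm x)).im) x) = 0 := by
  have hU : IsOpen (complexToPlane ⁻¹' Ω) := hΩ.preimage complexToPlane.continuous
  have hmem : ∀ x ∈ Ω, complexToPlane.symm x ∈ complexToPlane ⁻¹' Ω := fun x hx ↦ by
    rwa [Set.mem_preimage, LinearIsometryEquiv.apply_symm_apply]
  refine ⟨fun x hx ↦ ?_, fun x hx ↦ ?_, fun x hx ↦ ?_⟩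
  · exact HarmonicAt.comp_linearIsometryEquiv complexToPlane.symm
      (hG.analyticAt (hU.mem_nhds (hmem x hx))).harmonicAt_re
  · exact HarmonicAt.const_smul (c := s) (HarmonicAt.comp_linearIsometryEquiv complexToPlane.symm
      (hG.analyticAt (hU.mem_nhds (hmem x hx))).harmonicAt_im)
  · have hd := ((hG.differentiableAt (hU.mem_nhds (hmem x hx))).hasDerivAt.complexToReal_fderiv).comp
      x complexToPlane.symm.toContinuousLinearEquiv.hasFDerivAt
    have hre := (Complex.reCLM.hasFDerivAt.comp x hd).fderiv
    have him := ((Complex.imCLM.hasFDerivAt.comp x hd).const_mul s).fderiv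
    have e0 := complexToPlane_symm_single_zero
    have e1 := complexToPlane_symm_single_one
    set D := deriv G (complexToPlane.symm x)
    have hre' : ∀ p, fderiv ℝ (fun x ↦ (G (complexToPlane.symm x)).re) x p =
        (D * complexToPlane.symm p).re := fun p ↦ congr($hre p)
    have him' : ∀ p, fderiv ℝ (fun x ↦ s * (G (complexToPlane.symm x)).im) x p =
        s * (D * complexToPlane.symm p).im := fun p ↦ congr($him p)
    ext i
    fin_cases i
    · simp only [Fin.zero_eta, PiLp.add_apply, PiLp.smul_apply, rotQ_apply_zero,
        gradient_apply_eq_fderiv, hre', him', e0, e1]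
      simp
      linear_combination (-D.re) * hs
    · simp only [Fin.mk_one, PiLp.add_apply, PiLp.smul_apply, rotQ_apply_one,
        gradient_apply_eq_fderiv, hre', him', e0, e1]
      simp
      linear_combination D.im * hs

/-! ### Weak gradients -/

theorem setIntegral_eq_integral_of_tsupport_subset {Ω : Set Plane} {φ : Plane → ℝ}
    (hφ : tsupport φ ⊆ Ω) {E : Type*} [NormedAddCommGroup E] [NormedSpace ℝ E] {f : Plane → E}
    (hf : ∀ x, x ∉ tsupport φ → f x = 0) : ∫ x in Ω, f x = ∫ x, f x :=
  setIntegral_eq_integral_of_forall_compl_eq_zero fun x hx ↦ hf x fun h ↦ hx (hφ h)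

theorem fderiv_eq_zero_of_notMem_tsupport {φ : Plane → ℝ} {x : Plane} (hx : x ∉ tsupport φ) :
    fderiv ℝ φ x = 0 :=
  image_eq_zero_of_notMem_tsupport fun h ↦ hx (tsupport_fderiv_subset ℝ h)

theorem isWeakGradient_gradient (Ω : Set Plane) {u : Plane → ℝ} (hu : ContDiff ℝ 1 u) :
    IsWeakGradient Ω u (∇ u) := by
  intro φ hφ hc hs i
  have hφ1 : ContDiff ℝ 1 φ := hφ.of_le (by simp)
  have hu' := hu.continuous_fderiv one_ne_zero
  have hφ' := hφ1.continuous_fderiv one_ne_zero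
  have hcu := hu.continuous
  have hcφ := hφ.continuous
  simp only [gradient_apply_eq_fderiv]
  rw [setIntegral_eq_integral_of_tsupport_subset hs fun x hx ↦ by
      rw [fderiv_eq_zero_of_notMem_tsupport hx]; simp,
    setIntegral_eq_integral_of_tsupport_subset hs fun x hx ↦ by
      rw [image_eq_zero_of_notMem_tsupport hx]; simp]
  refine integral_mul_fderiv_eq_neg_fderiv_mul_of_integrable ?_ ?_ ?_
    (fun x _ ↦ hu.differentiable one_ne_zero x) (fun x _ ↦ hφ1.differentiable one_ne_zero x)
  · exact Continuous.integrable_of_hasCompactSupport (by fun_prop) hc.mul_left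
  · exact Continuous.integrable_of_hasCompactSupport (by fun_prop)
      (hc.fderiv_apply (𝕜 := ℝ) _).mul_left
  · exact Continuous.integrable_of_hasCompactSupport (by fun_prop) hc.mul_left

theorem IsWeakGradient.congr_ae {Ω : Set Plane} {u u' : Plane → ℝ} {g : Plane → Plane}
    (h : IsWeakGradient Ω u g) (huu' : u =ᵐ[volume.restrict Ω] u') : IsWeakGradient Ω u' g := by
  intro φ hφ hc hs i
  rw [← h φ hφ hc hs i]
  refine integral_congr_ae ?_
  filter_upwards [huu'] with x hx
  rw [hx]

theorem MemLp.plane_apply {Ω : Set Plane} {g : Plane → Plane}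
    (hg : MemLp g 2 (volume.restrict Ω)) (i : Fin 2) :
    MemLp (fun x ↦ g x i) 2 (volume.restrict Ω) :=
  hg.continuousLinearMap_comp (EuclideanSpace.proj i : Plane →L[ℝ] ℝ)

/-- Weak gradients are unique up to null sets. -/
theorem IsWeakGradient.ae_eq {Ω : Set Plane} (hΩ : IsOpen Ω) (hb : Bornology.IsBounded Ω)
    {u : Plane → ℝ} {g g' : Plane → Plane} (hg : MemLp g 2 (volume.restrict Ω))
    (hg' : MemLp g' 2 (volume.restrict Ω)) (h : IsWeakGradient Ω u g)
    (h' : IsWeakGradient Ω u g') : g =ᵐ[volume.restrict Ω] g' := by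
  have : IsFiniteMeasure (volume.restrict Ω) := ⟨by simpa using hb.measure_lt_top⟩
  have key : ∀ i, ∀ᵐ x ∂volume.restrict Ω, g x i = g' x i := fun i ↦ by
    have hi := ((MemLp.plane_apply hg i).integrable one_le_two)
    have hi' := ((MemLp.plane_apply hg' i).integrable one_le_two)
    rw [ae_restrict_iff' hΩ.measurableSet]
    -- The fundamental lemma of the calculus of variations, applied to one component of the
    -- difference.
    have := hΩ.ae_eq_zero_of_integral_contDiff_smul_eq_zero (μ := volume)
      (f := fun x ↦ g x i - g' x i) (IntegrableOn.locallyIntegrableOn (hi.sub hi')) ?_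
    · filter_upwards [this] with x hx hxΩ using sub_eq_zero.1 (hx hxΩ)
    · intro φ hφ hc hs
      rw [← setIntegral_eq_integral_of_tsupport_subset hs fun x hx ↦ by
        rw [image_eq_zero_of_notMem_tsupport hx, zero_smul]]
      obtain ⟨C, hC⟩ := hc.exists_bound_of_continuous hφ.continuous
      have hm : ∀ {f : Plane → ℝ}, Integrable f (volume.restrict Ω) →
          Integrable (fun x ↦ f x * φ x) (volume.restrict Ω) := fun hf ↦
        hf.mul_bdd (c := C) hφ.continuous.aestronglyMeasurable (.of_forall hC)
      have e := (h φ hφ hc hs i).symm.trans (h' φ hφ hc hs i)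
      rw [neg_inj] at e
      rw [integral_congr_ae (g := fun x ↦ g x i * φ x - g' x i * φ x)
        (.of_forall fun x ↦ by simp only [smul_eq_mul]; ring), integral_sub (hm hi) (hm hi'), e,
        sub_self]
  filter_upwards [key 0, key 1] with x h0 h1
  ext i
  fin_cases i
  exacts [h0, h1]

theorem weakGrad_ae_eq {Ω : Set Plane} (hΩ : IsOpen Ω) (hb : Bornology.IsBounded Ω)
    {u : Plane → ℝ} {g : Plane → Plane} (hu : MemH1 Ω u) (hg : MemLp g 2 (volume.restrict Ω))
    (h : IsWeakGradient Ω u g) : weakGrad Ω u =ᵐ[volume.restrict Ω] g :=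
  (weakGrad_spec hu).2.ae_eq hΩ hb (weakGrad_spec hu).1 hg h

/-! ### From weak Cauchy–Riemann pairs to holomorphic functions -/

/-- A pair of `H¹` functions with weak gradients satisfying the Cauchy–Riemann equations almost
everywhere consists, up to null sets, of the real and imaginary part of a holomorphic function. -/
theorem exists_differentiableOn_of_weakGrad {Ω : Set Plane} (hΩ : IsOpen Ω)
    (hb : Bornology.IsBounded Ω) {s : ℝ} (hs : s * s = 1) {u v : Plane → ℝ} (hu : MemH1 Ω u)
    (hv : MemH1 Ω v)
    (hCR : ∀ᵐ x ∂volume.restrict Ω, weakGrad Ω u x + s • rotQ (weakGrad Ω v x) = 0) :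
    ∃ G : ℂ → ℂ, DifferentiableOn ℂ G (complexToPlane ⁻¹' Ω) ∧
      (fun x ↦ (G (complexToPlane.symm x)).re) =ᵐ[volume.restrict Ω] u ∧
      (fun x ↦ s * (G (complexToPlane.symm x)).im) =ᵐ[volume.restrict Ω] v := by
  have : IsFiniteMeasure (volume.restrict Ω) := ⟨by simpa using hb.measure_lt_top⟩
  have hui := hu.1.integrable one_le_two
  have hvi := hv.1.integrable one_le_two
  set W : Plane → ℂ := fun x ↦ (u x : ℂ) + (s : ℂ) * Complex.I * (v x : ℂ)
  have hW : Integrable W (volume.restrict Ω) := hui.ofReal.add (hvi.ofReal.const_mul _)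
  have hmp := complexToPlane.measurePreserving
  have hme := complexToPlane.toHomeomorph.measurableEmbedding
  -- Extension by zero makes `F` integrable on all of `ℂ`; the weak equation is tested only inside
  -- `Ω`, so a jump at the boundary is harmless.
  set F : ℂ → ℂ := fun z ↦ Ω.indicator W (complexToPlane z)
  have hF : LocallyIntegrable F :=
    ((hmp.integrable_comp_emb hme).2 ((integrable_indicator_iff hΩ.measurableSet).2
      hW)).locallyIntegrable
  obtain ⟨G, hG, hGF⟩ := exists_differentiableOn_of_weak_cauchyRiemann
    (hΩ.preimage complexToPlane.continuous) hF fun ψ hψ hc hts ↦ by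
      set φ : Plane → ℝ := ψ ∘ complexToPlane.symm
      have hφ : ContDiff ℝ ∞ φ := hψ.comp complexToPlane.symm.contDiff
      have hcφ : HasCompactSupport φ := hc.comp_homeomorph complexToPlane.symm.toHomeomorph
      have htφ : tsupport φ ⊆ Ω := by
        have : tsupport φ = complexToPlane.symm ⁻¹' tsupport ψ :=
          tsupport_comp_eq_preimage ψ complexToPlane.symm.toHomeomorph
        rw [this]
        intro x hx
        have := hts hx
        rwa [Set.mem_preimage, LinearIsometryEquiv.apply_symm_apply] at this
      have hfd : ∀ x p, fderiv ℝ φ x p = fderiv ℝ ψ (complexToPlane.symm x)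
          (complexToPlane.symm p) := fun x p ↦ by
        have := ((hψ.differentiable (by simp)).differentiableAt
          (x := complexToPlane.symm x)).hasFDerivAt.comp x
            complexToPlane.symm.toContinuousLinearEquiv.hasFDerivAt
        exact congr($(this.fderiv) p)
      have htrans : ∀ p, ∫ z, (fderiv ℝ ψ z (complexToPlane.symm p)) • F z =
          ∫ x in Ω, (fderiv ℝ φ x p) • W x := fun p ↦ by
        rw [← integral_indicator hΩ.measurableSet, ← hmp.integral_comp hme]
        refine integral_congr_ae (.of_forall fun z ↦ ?_)
        by_cases hz : complexToPlane z ∈ Ω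
        · simp only [F, Set.indicator_of_mem hz, hfd]
          rw [LinearIsometryEquiv.symm_apply_apply]
        · simp only [F, Set.indicator_of_notMem hz, smul_zero]
      have hint : ∀ i : Fin 2, ∫ x in Ω, (fderiv ℝ φ x (EuclideanSpace.single i 1)) • W x =
          -((∫ x in Ω, weakGrad Ω u x i * φ x : ℝ) +
            s * Complex.I * (∫ x in Ω, weakGrad Ω v x i * φ x : ℝ)) := fun i ↦ by
        have hcont : Continuous fun x ↦ fderiv ℝ φ x (EuclideanSpace.single i 1) :=
          (hφ.continuous_fderiv (by simp)).clm_apply continuous_const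
        obtain ⟨C, hC⟩ := (hcφ.fderiv_apply (𝕜 := ℝ)
          (EuclideanSpace.single i 1)).exists_bound_of_continuous hcont
        have hm : ∀ {f : Plane → ℝ}, Integrable f (volume.restrict Ω) → Integrable
            (fun x ↦ f x * fderiv ℝ φ x (EuclideanSpace.single i 1)) (volume.restrict Ω) :=
          fun hf ↦ hf.mul_bdd (c := C) hcont.aestronglyMeasurable (.of_forall hC)
        have e : ∀ x, (fderiv ℝ φ x (EuclideanSpace.single i 1)) • W x =
            ((u x * fderiv ℝ φ x (EuclideanSpace.single i 1) : ℝ) : ℂ) +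
            s * Complex.I * ((v x * fderiv ℝ φ x (EuclideanSpace.single i 1) : ℝ) : ℂ) :=
          fun x ↦ by
            simp only [W, Complex.real_smul]
            push_cast
            ring
        simp only [e]
        rw [integral_add (hm hui).ofReal ((hm hvi).ofReal.const_mul _), integral_const_mul,
          integral_complex_ofReal, integral_complex_ofReal,
          (weakGrad_spec hu).2 φ hφ hcφ htφ i, (weakGrad_spec hv).2 φ hφ hcφ htφ i]
        push_cast
        ring
      have h0 : ∫ x in Ω, weakGrad Ω u x 0 * φ x = s * ∫ x in Ω, weakGrad Ω v x 1 * φ x := by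
        rw [← integral_const_mul]
        refine integral_congr_ae ?_
        filter_upwards [hCR] with x hx
        have := congr($hx 0)
        simp only [PiLp.add_apply, PiLp.smul_apply, PiLp.zero_apply, rotQ_apply_zero,
          smul_eq_mul] at this
        linear_combination φ x * this
      have h1 : ∫ x in Ω, weakGrad Ω u x 1 * φ x = -s * ∫ x in Ω, weakGrad Ω v x 0 * φ x := by
        rw [← integral_const_mul]
        refine integral_congr_ae ?_
        filter_upwards [hCR] with x hx
        have := congr($hx 1)
        simp only [PiLp.add_apply, PiLp.smul_apply, PiLp.zero_apply, rotQ_apply_one,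
          smul_eq_mul] at this
        linear_combination φ x * this
      have hd0 := htrans (EuclideanSpace.single 0 1)
      have hd1 := htrans (EuclideanSpace.single 1 1)
      rw [complexToPlane_symm_single_zero] at hd0
      rw [complexToPlane_symm_single_one] at hd1
      rw [hd0, hd1, hint, hint, h0, h1, smul_eq_mul]
      push_cast
      linear_combination s * (∫ x in Ω, weakGrad Ω v x 0 * φ x : ℝ) * Complex.I_sq
  have hGW : ∀ᵐ x ∂volume.restrict Ω, G (complexToPlane.symm x) = W x := by
    rw [ae_restrict_iff' hΩ.measurableSet]
    filter_upwards [complexToPlane.symm.measurePreserving.quasiMeasurePreserving.ae hGF] with x hx hxΩ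
    rw [hx (by rwa [Set.mem_preimage, LinearIsometryEquiv.apply_symm_apply])]
    simp only [F, LinearIsometryEquiv.apply_symm_apply]
    rw [Set.indicator_of_mem hxΩ]
  refine ⟨G, hG, ?_, ?_⟩
  · filter_upwards [hGW] with x hx
    rw [hx]
    simp [W]
  · filter_upwards [hGW] with x hx
    rw [hx]
    simp [W]
    linear_combination v x * hs

/-! ### Completing the square in the energy -/

theorem norm_sq_plane (p : Plane) : ‖p‖ ^ 2 = p 0 ^ 2 + p 1 ^ 2 := by
  simp [EuclideanSpace.norm_sq_eq]

/-- `Q` is an isometry and the cross term is `p · Qq = -det(p, q)`. -/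
theorem norm_sq_add_smul_rotQ {s : ℝ} (hs : s * s = 1) (p q : Plane) :
    ‖p + s • rotQ q‖ ^ 2 = ‖p‖ ^ 2 + ‖q‖ ^ 2 - 2 * s * detPair p q := by
  simp only [norm_sq_plane, PiLp.add_apply, PiLp.smul_apply, rotQ_apply_zero, rotQ_apply_one,
    detPair_eq, smul_eq_mul]
  linear_combination (q 0 ^ 2 + q 1 ^ 2) * hs

theorem integrable_detPair {Ω : Set Plane} {g h : Plane → Plane}
    (hg : MemLp g 2 (volume.restrict Ω)) (hh : MemLp h 2 (volume.restrict Ω)) :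
    Integrable (fun x ↦ detPair (g x) (h x)) (volume.restrict Ω) := by
  simp only [detPair_eq]
  exact ((MemLp.plane_apply hg 0).integrable_mul (MemLp.plane_apply hh 1)).sub
    ((MemLp.plane_apply hg 1).integrable_mul (MemLp.plane_apply hh 0))

theorem integrable_norm_sq_add {Ω : Set Plane} {u v : Plane → ℝ} (hu : MemH1 Ω u)
    (hv : MemH1 Ω v) : Integrable (fun x ↦ ‖weakGrad Ω u x‖ ^ 2 + ‖weakGrad Ω v x‖ ^ 2)
      (volume.restrict Ω) :=
  ((weakGrad_spec hu).1.integrable_norm_pow two_ne_zero).add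
    ((weakGrad_spec hv).1.integrable_norm_pow two_ne_zero)

theorem integrable_norm_sq_cauchyRiemann {Ω : Set Plane} {s : ℝ} (hs : s * s = 1)
    {u v : Plane → ℝ} (hu : MemH1 Ω u) (hv : MemH1 Ω v) :
    Integrable (fun x ↦ ‖weakGrad Ω u x + s • rotQ (weakGrad Ω v x)‖ ^ 2)
      (volume.restrict Ω) := by
  simp only [norm_sq_add_smul_rotQ hs]
  exact (integrable_norm_sq_add hu hv).sub
    ((integrable_detPair (weakGrad_spec hu).1 (weakGrad_spec hv).1).const_mul _)

/-- The Dirichlet energy is the null Lagrangian plus a nonnegative Cauchy–Riemann defect. -/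
theorem dirichletEnergy_eq {Ω : Set Plane} {s c : ℝ} (hs : s * s = 1) {u v : Plane → ℝ}
    (h : IsAdmissible Ω c u v) :
    dirichletEnergy Ω u v =
      s * c + (1 / 2) * ∫ x in Ω, ‖weakGrad Ω u x + s • rotQ (weakGrad Ω v x)‖ ^ 2 := by
  obtain ⟨hu, hv, rfl⟩ := h
  simp only [norm_sq_add_smul_rotQ hs, dirichletEnergy]
  rw [integral_sub (integrable_norm_sq_add hu hv)
    ((integrable_detPair (weakGrad_spec hu).1 (weakGrad_spec hv).1).const_mul _),
    integral_const_mul]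
  ring

theorem mul_le_dirichletEnergy {Ω : Set Plane} {s c : ℝ} (hs : s * s = 1) {u v : Plane → ℝ}
    (h : IsAdmissible Ω c u v) : s * c ≤ dirichletEnergy Ω u v := by
  rw [dirichletEnergy_eq hs h]
  have : 0 ≤ ∫ x in Ω, ‖weakGrad Ω u x + s • rotQ (weakGrad Ω v x)‖ ^ 2 :=
    integral_nonneg fun x ↦ by positivity
  linarith

theorem dirichletEnergy_eq_mul_iff {Ω : Set Plane} {s c : ℝ} (hs : s * s = 1) {u v : Plane → ℝ}
    (h : IsAdmissible Ω c u v) : dirichletEnergy Ω u v = s * c ↔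
      ∀ᵐ x ∂volume.restrict Ω, weakGrad Ω u x + s • rotQ (weakGrad Ω v x) = 0 := by
  rw [dirichletEnergy_eq hs h, add_eq_left, mul_eq_zero_iff_left (by norm_num),
    integral_eq_zero_iff_of_nonneg (fun x ↦ by positivity)
      (integrable_norm_sq_cauchyRiemann hs h.1 h.2.1)]
  refine Filter.eventually_congr (.of_forall fun x ↦ ?_)
  simp

/-! ### Linear competitors and non-constancy -/

theorem memLp_coord {Ω : Set Plane} (hb : Bornology.IsBounded Ω)
    (hΩ : IsOpen Ω) (a : ℝ) (i : Fin 2) :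
    MemLp (fun x : Plane ↦ a * x i) 2 (volume.restrict Ω) := by
  have : IsFiniteMeasure (volume.restrict Ω) := ⟨by simpa using hb.measure_lt_top⟩
  obtain ⟨C, hC⟩ := hb.exists_norm_le
  refine MemLp.of_bound (by fun_prop) (|a| * C) ?_
  filter_upwards [ae_restrict_mem hΩ.measurableSet] with x hx
  rw [norm_mul, Real.norm_eq_abs]
  gcongr
  exact (PiLp.norm_apply_le x i).trans (hC x hx)

theorem gradient_coord (a : ℝ) (i : Fin 2) (x : Plane) :
    ∇ (fun x : Plane ↦ a * x i) x = EuclideanSpace.single i a := by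
  ext j
  have h : HasFDerivAt (fun x : Plane ↦ a * x i)
      (a • (EuclideanSpace.proj i : Plane →L[ℝ] ℝ)) x :=
    ((EuclideanSpace.proj i : Plane →L[ℝ] ℝ).hasFDerivAt).const_mul a
  rw [gradient_apply_eq_fderiv, h.fderiv]
  fin_cases i <;> fin_cases j <;> simp

theorem memH1_coord {Ω : Set Plane} (hb : Bornology.IsBounded Ω) (hΩ : IsOpen Ω) (a : ℝ)
    (i : Fin 2) : MemH1 Ω (fun x ↦ a * x i) ∧
      weakGrad Ω (fun x ↦ a * x i) =ᵐ[volume.restrict Ω] fun _ ↦ EuclideanSpace.single i a := by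
  have : IsFiniteMeasure (volume.restrict Ω) := ⟨by simpa using hb.measure_lt_top⟩
  have hw : IsWeakGradient Ω (fun x ↦ a * x i) fun _ ↦ EuclideanSpace.single i a := by
    have := isWeakGradient_gradient Ω (u := fun x ↦ a * x i) (by fun_prop)
    rwa [funext (gradient_coord a i)] at this
  have hL : MemLp (fun _ : Plane ↦ (EuclideanSpace.single i a : Plane)) 2
    (volume.restrict Ω) := memLp_const _
  have h1 : MemH1 Ω (fun x ↦ a * x i) := ⟨memLp_coord hb hΩ a i, _, hL, hw⟩
  exact ⟨h1, weakGrad_ae_eq hΩ hb h1 hL hw⟩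

theorem weakGrad_ae_eq_zero_of_ae_const {Ω : Set Plane} (hb : Bornology.IsBounded Ω)
    (hΩ : IsOpen Ω) {u : Plane → ℝ} {a : ℝ} (hu : MemH1 Ω u)
    (h : u =ᵐ[volume.restrict Ω] fun _ ↦ a) : weakGrad Ω u =ᵐ[volume.restrict Ω] 0 := by
  have hw : IsWeakGradient Ω (fun _ ↦ a) 0 := by
    have := isWeakGradient_gradient Ω (u := fun _ ↦ a) (by fun_prop)
    rwa [gradient_fun_const'] at this
  exact weakGrad_ae_eq hΩ hb hu MemLp.zero (hw.congr_ae h.symm)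

/-- The components of an admissible pair are not constant when the constraint is nontrivial. -/
theorem IsAdmissible.not_ae_const {Ω : Set Plane} (hb : Bornology.IsBounded Ω) (hΩ : IsOpen Ω)
    {c : ℝ} (hc : c ≠ 0) {u v : Plane → ℝ} (h : IsAdmissible Ω c u v) (a : ℝ) :
    ¬ (u =ᵐ[volume.restrict Ω] fun _ ↦ a) ∧ ¬ (v =ᵐ[volume.restrict Ω] fun _ ↦ a) := by
  refine ⟨fun hu ↦ hc ?_, fun hv ↦ hc ?_⟩
  · rw [← h.2.2]
    refine integral_eq_zero_of_ae ?_
    filter_upwards [weakGrad_ae_eq_zero_of_ae_const hb hΩ h.1 hu] with x hx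
    simp [detPair_eq, hx]
  · rw [← h.2.2]
    refine integral_eq_zero_of_ae ?_
    filter_upwards [weakGrad_ae_eq_zero_of_ae_const hb hΩ h.2.1 hv] with x hx
    simp [detPair_eq, hx]

/-- A suitable multiple of the identity, up to a reflection, attains the lower energy bound. -/
theorem exists_linear_admissible {Ω : Set Plane} (hb : Bornology.IsBounded Ω) (hΩ : IsOpen Ω)
    (hne : Ω.Nonempty) {s c : ℝ} (hs : s * s = 1) (hsc : 0 ≤ s * c) :
    ∃ a : ℝ, IsAdmissible Ω c (fun x ↦ a * x 0) (fun x ↦ s * a * x 1) ∧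
      dirichletEnergy Ω (fun x ↦ a * x 0) (fun x ↦ s * a * x 1) = s * c := by
  have hvol : 0 < volume.real Ω := by
    rw [measureReal_def]
    exact ENNReal.toReal_pos (hΩ.measure_pos volume hne).ne' hb.measure_lt_top.ne
  -- The linear pair has determinant `s * a ^ 2`, so the constraint forces `a ^ 2 = s * c / |Ω|`, as
  -- `s * s = 1`.
  set a := Real.sqrt (s * c / volume.real Ω)
  have ha : a ^ 2 = s * c / volume.real Ω := Real.sq_sqrt (by positivity)
  obtain ⟨hu, hgu⟩ := memH1_coord hb hΩ a 0
  obtain ⟨hv, hgv⟩ := memH1_coord hb hΩ (s * a) 1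
  have hadm : IsAdmissible Ω c (fun x ↦ a * x 0) (fun x ↦ s * a * x 1) := by
    refine ⟨hu, hv, ?_⟩
    rw [integral_congr_ae (g := fun _ ↦ s * a ^ 2)]
    · simp only [integral_const, measureReal_restrict_apply_univ, smul_eq_mul, ha]
      field_simp
      linear_combination c * hs
    · filter_upwards [hgu, hgv] with x h1 h2
      rw [h1, h2]
      simp [detPair_eq]
      ring
  refine ⟨a, hadm, (dirichletEnergy_eq_mul_iff hs hadm).2 ?_⟩
  filter_upwards [hgu, hgv] with x h1 h2
  rw [h1, h2]
  ext i
  fin_cases i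
  · simp [rotQ_apply_zero]
    linear_combination (-a) * hs
  · simp [rotQ_apply_one]

/-! ### Characterisation of the minimisers and conclusion -/

/-- The lower bound `s * c` is attained by a linear pair, so minimality means energy exactly `s *
c`, that is, zero Cauchy–Riemann defect. -/
theorem isConstrainedMinimizer_iff {Ω : Set Plane} (hb : Bornology.IsBounded Ω) (hΩ : IsOpen Ω)
    (hne : Ω.Nonempty) {s c : ℝ} (hs : s * s = 1) (hsc : 0 ≤ s * c) {u v : Plane → ℝ} :
    IsConstrainedMinimizer Ω c u v ↔ IsAdmissible Ω c u v ∧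
      ∀ᵐ x ∂volume.restrict Ω, weakGrad Ω u x + s • rotQ (weakGrad Ω v x) = 0 := by
  refine and_congr_right fun h ↦ ?_
  rw [← dirichletEnergy_eq_mul_iff hs h]
  refine ⟨fun hmin ↦ ?_, fun he u' v' h' ↦ he.trans_le (mul_le_dirichletEnergy hs h')⟩
  obtain ⟨a, ha, hE⟩ := exists_linear_admissible hb hΩ hne hs hsc
  exact le_antisymm ((hmin _ _ ha).trans_eq hE) (mul_le_dirichletEnergy hs h)

theorem satisfiesOptimality_of_cauchyRiemann {Ω : Set Plane} {s : ℝ} (hs : s * s = 1)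
    {u v : Plane → ℝ}
    (h : ∀ᵐ x ∂volume.restrict Ω, weakGrad Ω u x + s • rotQ (weakGrad Ω v x) = 0) :
    SatisfiesOptimality Ω s u v := by
  refine fun U _ ↦ ⟨integral_eq_zero_of_ae ?_, integral_eq_zero_of_ae ?_⟩
  · filter_upwards [h] with x hx
    simp [hx]
  · filter_upwards [h] with x hx
    -- This vector is `-s Q` applied to the one in `hx`, because `Q² = -1` and `s * s = 1`.
    have : weakGrad Ω v x - s • rotQ (weakGrad Ω u x) = 0 := by
      have h0 := congr($hx 0)
      have h1 := congr($hx 1)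
      simp only [PiLp.add_apply, PiLp.smul_apply, PiLp.zero_apply, rotQ_apply_zero,
        rotQ_apply_one, smul_eq_mul] at h0 h1
      ext i
      fin_cases i
      · simp [rotQ_apply_zero]
        linear_combination s * h1 - weakGrad Ω v x 0 * hs
      · simp [rotQ_apply_one]
        linear_combination (-s) * h0 - weakGrad Ω v x 1 * hs
    simp [this]

/-- Holomorphic representatives of an admissible pair form a nontrivial conjugate pair. -/
theorem isNontrivialConjugatePair_of_differentiableOn {Ω : Set Plane}
    (hb : Bornology.IsBounded Ω) (hΩ : IsOpen Ω) {s c : ℝ} (hs : s * s = 1) (hc : c ≠ 0)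
    {u v : Plane → ℝ} (h : IsAdmissible Ω c u v) {G : ℂ → ℂ}
    (hG : DifferentiableOn ℂ G (complexToPlane ⁻¹' Ω))
    (hGu : (fun x ↦ (G (complexToPlane.symm x)).re) =ᵐ[volume.restrict Ω] u)
    (hGv : (fun x ↦ s * (G (complexToPlane.symm x)).im) =ᵐ[volume.restrict Ω] v) :
    IsNontrivialConjugatePair Ω s (fun x ↦ (G (complexToPlane.symm x)).re)
      (fun x ↦ s * (G (complexToPlane.symm x)).im) := by
  obtain ⟨h1, h2, h3⟩ := harmonic_cauchyRiemann_of_differentiableOn hΩ hs hG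
  refine ⟨h1, h2, fun ⟨a, ha⟩ ↦ (h.not_ae_const hb hΩ hc a).1 (hGu.symm.trans ?_),
    fun ⟨a, ha⟩ ↦ (h.not_ae_const hb hΩ hc a).2 (hGv.symm.trans ?_), h3⟩
  · filter_upwards [ae_restrict_mem hΩ.measurableSet] with x hx using ha x hx
  · filter_upwards [ae_restrict_mem hΩ.measurableSet] with x hx using ha x hx

theorem mainTheorem7 (Ω : Set Plane) (hopen : IsOpen Ω) (hconn : IsConnected Ω)
    (hbdd : Bornology.IsBounded Ω) :
    -- non-trivial Cauchy-Riemann pairs of harmonic functions, as constrained minimisers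
    (∀ c : ℝ, 0 < c → ∃ u v : Plane → ℝ,
      IsConstrainedMinimizer Ω c u v ∧ IsNontrivialConjugatePair Ω 1 u v) ∧
    -- minimisers exist for each non-zero constant, and every minimiser is such a pair
    -- (up to null sets, and with the sign of the constant)
    (∀ c : ℝ, c ≠ 0 →
      (∃ u v : Plane → ℝ, IsConstrainedMinimizer Ω c u v) ∧
      ∀ u v : Plane → ℝ, IsConstrainedMinimizer Ω c u v →
        SatisfiesOptimality Ω (Real.sign c) u v ∧
        ∃ u' v' : Plane → ℝ,
          u' =ᵐ[volume.restrict Ω] u ∧ v' =ᵐ[volume.restrict Ω] v ∧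
          IsNontrivialConjugatePair Ω (Real.sign c) u' v') := by
  have hne := hconn.nonempty
  refine ⟨fun c hc ↦ ?_, fun c hc ↦ ?_⟩
  · obtain ⟨a, ha, hE⟩ := exists_linear_admissible hbdd hopen hne (one_mul (1 : ℝ))
      (c := c) (by linarith)
    -- For `c > 0` the linear minimiser is itself given by the holomorphic function `a z`, so no
    -- change on a null set is needed.
    have hu : (fun x : Plane ↦ ((a : ℂ) * complexToPlane.symm x).re) = fun x ↦ a * x 0 := by
      funext x
      simp
    have hv : (fun x : Plane ↦ 1 * ((a : ℂ) * complexToPlane.symm x).im) =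
        fun x ↦ 1 * a * x 1 := by
      funext x
      simp
    have := isNontrivialConjugatePair_of_differentiableOn hbdd hopen (one_mul (1 : ℝ)) hc.ne' ha
      (G := fun z ↦ (a : ℂ) * z) (by fun_prop) (.of_eq hu) (.of_eq hv)
    rw [hu, hv] at this
    exact ⟨_, _, (isConstrainedMinimizer_iff hbdd hopen hne (one_mul (1 : ℝ)) (by linarith)).2
      ⟨ha, (dirichletEnergy_eq_mul_iff (one_mul (1 : ℝ)) ha).1 hE⟩, this⟩
  · have hs : Real.sign c * Real.sign c = 1 := by
      rcases Real.sign_apply_eq_of_ne_zero c hc with h | h <;> simp [h]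
    have hsc : 0 ≤ Real.sign c * c := Real.sign_mul_nonneg c
    refine ⟨?_, fun u v huv ↦ ?_⟩
    · obtain ⟨a, ha, hE⟩ := exists_linear_admissible hbdd hopen hne hs hsc
      exact ⟨_, _, (isConstrainedMinimizer_iff hbdd hopen hne hs hsc).2
        ⟨ha, (dirichletEnergy_eq_mul_iff hs ha).1 hE⟩⟩
    · obtain ⟨hadm, hCR⟩ := (isConstrainedMinimizer_iff hbdd hopen hne hs hsc).1 huv
      obtain ⟨G, hG, hGu, hGv⟩ :=
        exists_differentiableOn_of_weakGrad hopen hbdd hs hadm.1 hadm.2.1 hCR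
      exact ⟨satisfiesOptimality_of_cauchyRiemann hs hCR, _, _, hGu, hGv,
        isNontrivialConjugatePair_of_differentiableOn hbdd hopen hs hc hadm hG hGu hGv⟩
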